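/- Let $n,m\ge 0$ be integers and let $p_3$ be a real polynomial of degree at most $3$ in $x=(x_1,\dots,x_n)$. Consider tuples $Z=(P^i,r^i,w^i,Q^i,f^i,g^i,P',r',w')_{i\in[n]}$ with $P^i,Q^i,P'\in\mathbb R^{n\times n}$, $r^i,f^i,r'\in\mathbb R^n$, $w^i,g^i,w'\in\mathbb R$, and set $p^i(x)=x^TP^ix+x^Tr^i+w^i$, $q^i(x)=x^TQ^ix+x^Tf^i+g^i$, $\beta(x)=x^TP'x+x^Tr'+w'$. Let $$\sum_{i=1}^n\Big(\langle A_j^i,P^i\rangle+\langle B_j^i,Q^i\rangle+(c_j^i)^Tr^i+(d_j^i)^Tf^i+\mu_j^iw^i+\nu_j^ig^i\Big)+\langle\Xi_j,P'\rangle+\omega_j^Tr'+\gamma_jw'=s_j,\qquad j\in[m],$$ with symmetric matrices $A_j^i,B_j^i,\Xi_j$, be a system of linear equations in $Z$ that expresses coefficient matching with $p_3$: $Z$ solves the system if and only if $\sum_i x_ip^i(x)+\sum_i(1-x_i)q^i(x)+\beta(x)=p_3(x)$ for all $x\in\mathbb R^n$. Let $\mathcal Z$ be the set of all solutions $Z$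 with $P^i,Q^i,P'\succeq 0$ for all $i\in[n]$; these are the decompositions of $p_3$ into a sum of linear times convex quadratic functions (SLC decompositions). For $x\in[0,1]^n$ and $U\in\mathbb R^{n\times n}$ with rows $U_1,\dots,U_n$ (written as column vectors), and for $Z\in\mathcal Z$, let $$g_3(x,U,Z)=\sum_{i=1}^n\Big(\tfrac1{x_i}U_i^TP^iU_i+U_i^Tr^i+w^ix_i+\tfrac1{1-x_i}(x-U_i)^TQ^i(x-U_i)+(x-U_i)^Tf^i+(1-x_i)g^i\Big)+x^TP'x+x^Tr'+w',$$ with the convention $a/0=+\infty$ for $a>0$ and $0/0=0$. Let $\overline{\mathcal X}\subseteq\mathbb R^n\times\mathbb R^{n\times n}$ be any set such that $x\in[0,1]^n$ for all $(x,U)\in\overline{\mathcal X}$. Consider the min–max problem $$\min_{(x,U)\in\overline{\mathcal X}}\ \max_{Z\in\mathcal Z}\ g_3(x,U,Z),\tag{1}$$ where the inner maximum is understood as a supremum in $[-\infty,+\infty]$, and $(x,U)\in\overline{\mathcal X}$ is called optimal for (1) if its inner value is not $+\infty$ and is minimal over $\overline{\mathcal X}$. Consider also the problem in the variables $x\in\mathbb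 R^n$, $U\in\mathbb R^{n\times n}$, $Y=(Y^1,\dots,Y^{n+1})$ and $R=(R^1,\dots,R^n)$ with $Y^i,R^i\in\mathbb R^{n\times n}$, and $\lambda\in\mathbb R^m$: $$\begin{aligned}\min\quad&-\sum_{j=1}^m\lambda_js_j\\ \text{s.t.}\quad &Y^i+\sum_j\lambda_jA_j^i\preceq0,\quad R^i+\sum_j\lambda_jB_j^i\preceq0,\quad i\in[n],\qquad Y^{n+1}+\sum_j\lambda_j\Xi_j\preceq0,\\ &U_i+\sum_j\lambda_jc_j^i=0,\quad x-U_i+\sum_j\lambda_jd_j^i=0,\quad i\in[n],\qquad x+\sum_j\lambda_j\omega_j=0,\\ &x_i+\sum_j\lambda_j\mu_j^i=0,\quad 1-x_i+\sum_j\lambda_j\nu_j^i=0,\quad i\in[n],\qquad 1+\sum_j\lambda_j\gamma_j=0,\\ &\begin{pmatrix}Y^i&U_i\\U_i^T&x_i\end{pmatrix}\succeq0,\quad\begin{pmatrix}R^i&x-U_i\\(x-U_i)^T&1-x_i\end{pmatrix}\succeq0,\quad i\in[n],\qquad\begin{pmatrix}Y^{n+1}&x\\x^T&1\end{pmatrix}\succeq0,\\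 &(x,U)\in\overline{\mathcal X}.\end{aligned}\tag{2}$$ Then $(x,U)$ is an optimal solution of (1) if and only if there exist $(Y,R,\lambda)$ such that $(x,U,Y,R,\lambda)$ is an optimal solution of (2). Moreover, the optimal values (infima in $[-\infty,+\infty]$) of (1) and (2) are equal. -/

import Mathlib

open scoped Matrix

noncomputable section

namespace SLC

/-- The coefficients `Z` of a decomposition
`∑ i, x i * pᵢ(x) + ∑ i, (1 - x i) * qᵢ(x) + β(x)` into linear times quadratic functions, where
`pᵢ(x) = xᵀ Pⁱ x + xᵀ rⁱ + wⁱ`, `qᵢ(x) = xᵀ Qⁱ x + xᵀ fⁱ + gⁱ`, `β(x) = xᵀ P' x + xᵀ r' + w'`. -/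
structure Coeffs (n : ℕ) where
  P : Fin n → Matrix (Fin n) (Fin n) ℝ
  r : Fin n → Fin n → ℝ
  w : Fin n → ℝ
  Q : Fin n → Matrix (Fin n) (Fin n) ℝ
  f : Fin n → Fin n → ℝ
  g : Fin n → ℝ
  P' : Matrix (Fin n) (Fin n) ℝ
  r' : Fin n → ℝ
  w' : ℝ

/-- The quadratic function `xᵀ M x + xᵀ v + c`. -/
def quadratic {n : ℕ} (M : Matrix (Fin n) (Fin n) ℝ) (v : Fin n → ℝ) (c : ℝ)
    (x : Fin n → ℝ) : ℝ :=
  x ⬝ᵥ (M *ᵥ x) + x ⬝ᵥ v + c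

/-- The function `∑ i, x i * pᵢ(x) + ∑ i, (1 - x i) * qᵢ(x) + β(x)` with coefficients `Z`. -/
def Coeffs.toFun {n : ℕ} (Z : Coeffs n) (x : Fin n → ℝ) : ℝ :=
  ∑ i, x i * quadratic (Z.P i) (Z.r i) (Z.w i) x
    + ∑ i, (1 - x i) * quadratic (Z.Q i) (Z.f i) (Z.g i) x
    + quadratic Z.P' Z.r' Z.w' x

/-- The inner product `⟨A, B⟩ = tr(Aᵀ B)` of matrices. -/
def matInner {n : ℕ} (A B : Matrix (Fin n) (Fin n) ℝ) : ℝ := (Aᵀ * B).trace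

/-- The data of `m` linear equations in the unknown coefficients `Z`: in the `j`-th equation,
`A j i, B j i, c j i, d j i, μ j i, ν j i, Ξ j, ω j, γ j` multiply
`Pⁱ, Qⁱ, rⁱ, fⁱ, wⁱ, gⁱ, P', r', w'` respectively, and `s j` is the right-hand side. -/
structure EqSystem (n m : ℕ) where
  A : Fin m → Fin n → Matrix (Fin n) (Fin n) ℝ
  B : Fin m → Fin n → Matrix (Fin n) (Fin n) ℝ
  c : Fin m → Fin n → Fin n → ℝ
  d : Fin m → Fin n → Fin n → ℝ
  μ : Fin m → Fin n → ℝ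
  ν : Fin m → Fin n → ℝ
  Ξ : Fin m → Matrix (Fin n) (Fin n) ℝ
  ω : Fin m → Fin n → ℝ
  γ : Fin m → ℝ
  s : Fin m → ℝ

namespace EqSystem

variable {n m : ℕ}

/-- The left-hand side of the `j`-th equation. -/
def lhs (D : EqSystem n m) (j : Fin m) (Z : Coeffs n) : ℝ :=
  ∑ i, (matInner (D.A j i) (Z.P i) + matInner (D.B j i) (Z.Q i)
      + D.c j i ⬝ᵥ Z.r i + D.d j i ⬝ᵥ Z.f i + D.μ j i * Z.w i + D.ν j i * Z.g i)
    + matInner (D.Ξ j) Z.P' + D.ω j ⬝ᵥ Z.r' + D.γ j * Z.w'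

/-- `Z` solves all the equations. -/
def Solves (D : EqSystem n m) (Z : Coeffs n) : Prop := ∀ j, D.lhs j Z = D.s j

/-- The equations express coefficient matching with the polynomial `p`: `Z` solves them
if and only if the decomposition with coefficients `Z` is equal to `p`.  As always for data of
semidefinite programs, the matrices in the equations are symmetric. -/
structure Matches (D : EqSystem n m) (p : MvPolynomial (Fin n) ℝ) : Prop where
  symm_A : ∀ j i, (D.A j i).IsSymm
  symm_B : ∀ j i, (D.B j i).IsSymm
  symm_Ξ : ∀ j, (D.Ξ j).IsSymm
  solves_iff : ∀ Z : Coeffs n, D.Solves Z ↔ ∀ x : Fin n → ℝ, Z.toFun x = MvPolynomial.eval x p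

/-- The set `𝒵`: solutions of the equations whose quadratics are convex. -/
def feasibleCoeffs (D : EqSystem n m) : Set (Coeffs n) :=
  {Z | D.Solves Z ∧ (∀ i, (Z.P i).PosSemidef) ∧ (∀ i, (Z.Q i).PosSemidef) ∧ Z.P'.PosSemidef}

end EqSystem

/-- The quotient `uᵀ M u / t`, with the usual convention for perspectives of convex functions at
`t = 0`: there it is `0` if `uᵀ M u = 0` and `+∞` otherwise (used for `M ⪰ 0` and `t ≥ 0`). -/
def quadOverLin {n : ℕ} (M : Matrix (Fin n) (Fin n) ℝ) (u : Fin n → ℝ) (t : ℝ) : EReal :=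
  if t = 0 then (if u ⬝ᵥ (M *ᵥ u) = 0 then 0 else ⊤)
  else (((1 / t) * (u ⬝ᵥ (M *ᵥ u)) : ℝ) : EReal)

/-- The convex relaxation `g₃(x, U, Z)`; `U i` is the `i`-th row of `U`, which stands for
`x i • x`. -/
def g₃ {n : ℕ} (x : Fin n → ℝ) (U : Matrix (Fin n) (Fin n) ℝ) (Z : Coeffs n) : EReal :=
  ∑ i, (quadOverLin (Z.P i) (U i) (x i)
      + ((U i ⬝ᵥ Z.r i + Z.w i * x i : ℝ) : EReal)
      + quadOverLin (Z.Q i) (x - U i) (1 - x i)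
      + (((x - U i) ⬝ᵥ Z.f i + (1 - x i) * Z.g i : ℝ) : EReal))
    + ((x ⬝ᵥ (Z.P' *ᵥ x) + x ⬝ᵥ Z.r' + Z.w' : ℝ) : EReal)

/-- The value of the inner problem `max_{Z ∈ 𝒵} g₃(x, U, Z)`, as a supremum in `[-∞, +∞]`. -/
def innerMax {n m : ℕ} (D : EqSystem n m) (x : Fin n → ℝ) (U : Matrix (Fin n) (Fin n) ℝ) :
    EReal :=
  ⨆ Z ∈ D.feasibleCoeffs, g₃ x U Z

/-- `(x, U)` is an optimal solution of `min_{(x, U) ∈ Xbar} max_{Z ∈ 𝒵} g₃(x, U, Z)`: it is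
feasible, with an inner value that is not `+∞`, and no feasible point has a smaller inner value. -/
def IsMinMaxOptimal {n m : ℕ} (D : EqSystem n m)
    (Xbar : Set ((Fin n → ℝ) × Matrix (Fin n) (Fin n) ℝ))
    (x : Fin n → ℝ) (U : Matrix (Fin n) (Fin n) ℝ) : Prop :=
  (x, U) ∈ Xbar ∧ innerMax D x U ≠ ⊤ ∧
    ∀ x' U', (x', U') ∈ Xbar → innerMax D x U ≤ innerMax D x' U'

/-- The `(n+1) × (n+1)` matrix with blocks `M, v, vᵀ, t`. -/
def bordered {n : ℕ} (M : Matrix (Fin n) (Fin n) ℝ) (v : Fin n → ℝ) (t : ℝ) :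
    Matrix (Fin n ⊕ Unit) (Fin n ⊕ Unit) ℝ :=
  Matrix.fromBlocks M (Matrix.replicateCol Unit v) (Matrix.replicateRow Unit v)
    (Matrix.of fun _ _ => t)

/-- The variables `(x, U, Y, R, λ)` of the semidefinite program; `Y` consists of
`Y¹, …, Yⁿ, Yⁿ⁺¹`, where `Yⁿ⁺¹` is `Y (Fin.last n)`. -/
structure SDPVar (n m : ℕ) where
  x : Fin n → ℝ
  U : Matrix (Fin n) (Fin n) ℝ
  Y : Fin (n + 1) → Matrix (Fin n) (Fin n) ℝ
  R : Fin n → Matrix (Fin n) (Fin n) ℝ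
  lam : Fin m → ℝ

/-- The constraints of the semidefinite program; `M ⪯ 0` is `(-M).PosSemidef`. -/
structure SDPFeasible {n m : ℕ} (D : EqSystem n m)
    (Xbar : Set ((Fin n → ℝ) × Matrix (Fin n) (Fin n) ℝ)) (v : SDPVar n m) : Prop where
  lmi_A : ∀ i : Fin n, (-(v.Y i.castSucc + ∑ j, v.lam j • D.A j i)).PosSemidef
  lmi_B : ∀ i : Fin n, (-(v.R i + ∑ j, v.lam j • D.B j i)).PosSemidef
  lmi_Ξ : (-(v.Y (Fin.last n) + ∑ j, v.lam j • D.Ξ j)).PosSemidef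
  eq_c : ∀ i : Fin n, v.U i + ∑ j, v.lam j • D.c j i = 0
  eq_d : ∀ i : Fin n, v.x - v.U i + ∑ j, v.lam j • D.d j i = 0
  eq_ω : v.x + ∑ j, v.lam j • D.ω j = 0
  eq_μ : ∀ i : Fin n, v.x i + ∑ j, v.lam j * D.μ j i = 0
  eq_ν : ∀ i : Fin n, 1 - v.x i + ∑ j, v.lam j * D.ν j i = 0
  eq_γ : 1 + ∑ j, v.lam j * D.γ j = 0
  lmi_Y : ∀ i : Fin n, (bordered (v.Y i.castSucc) (v.U i) (v.x i)).PosSemidef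
  lmi_R : ∀ i : Fin n, (bordered (v.R i) (v.x - v.U i) (1 - v.x i)).PosSemidef
  lmi_Y_last : (bordered (v.Y (Fin.last n)) v.x 1).PosSemidef
  mem : (v.x, v.U) ∈ Xbar

/-- The objective `-∑ j, λ j * s j` of the semidefinite program. -/
def sdpObjective {n m : ℕ} (D : EqSystem n m) (v : SDPVar n m) : ℝ := -∑ j, v.lam j * D.s j

/-- `v` is an optimal solution of the semidefinite program. -/
def IsSDPOptimal {n m : ℕ} (D : EqSystem n m)
    (Xbar : Set ((Fin n → ℝ) × Matrix (Fin n) (Fin n) ℝ)) (v : SDPVar n m) : Prop :=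
  SDPFeasible D Xbar v ∧ ∀ v', SDPFeasible D Xbar v' → sdpObjective D v ≤ sdpObjective D v'

end SLC

end

noncomputable section

namespace SLC

open Matrix

/-! Fix `(x, U)`. Where `g₃` is finite it is linear in the coefficients `Z`, so the inner problem is
a conic linear program, and (2) with `(x, U)` frozen is its dual. Two facts suffice: dual values
bound the inner supremum (`innerMax_le_sdpObjective`), and a finite supremum is attained by a dual
point (`exists_sdpFeasible_le_innerMax`). Minimizing over `(x, U)` then matches optima and values.

Weak duality pairs each constraint with a convex quadratic, using that the Schur complement of a
bordered matrix is positive semidefinite. Strong duality needs a Slater point: degree at most 3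
gives some decomposition of `p`, and adding a large multiple of a decomposition of zero with
identity matrices makes every block strictly convex. At this point `g₃` is `+∞` whenever a zero
weight meets a nonzero vector, so a finite supremum excludes that case. `exists_dual_solution` then
gives the multipliers, and testing on single blocks yields the constraints of (2). -/

/-! ### Conic duality under a Slater condition -/

/-- Strong duality for linear optimization over a pointed cone: under a Slater condition, a bound
on the values of the primal problem is certified by a dual solution. -/
theorem exists_dual_solution {V : Type*} [AddCommGroup V] [Module ℝ V] {m : ℕ}
    (K : PointedCone ℝ V) (a : Fin m → V →ₗ[ℝ] ℝ) (s : Fin m → ℝ) (L : V →ₗ[ℝ] ℝ) {z₀ : V}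
    (hz₀ : z₀ ∈ K) (ha : ∀ j, a j z₀ = s j) (hint : ∀ z, ∃ N : ℝ, 0 ≤ N ∧ N • z₀ + z ∈ K) {v : ℝ}
    (hv : ∀ z ∈ K, (∀ j, a j z = s j) → L z ≤ v) :
    ∃ lam : Fin m → ℝ, (∀ z ∈ K, L z + ∑ j, lam j * a j z ≤ 0) ∧ -∑ j, lam j * s j ≤ v := by
  have hsmul : ∀ {c : ℝ} {z : V}, 0 ≤ c → z ∈ K → c • z ∈ K := fun {c z} hc hz =>
    K.smul_mem hc hz
  -- Homogenize: the equations become a subspace `W` of `V × ℝ`, and the bound `v` becomes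
  -- nonnegativity of `φ` on `W ∩ (K × ℝ≥0)`. Riesz extension needs no topology and no closedness of
  -- `K`.
  let b : Fin m → V × ℝ →ₗ[ℝ] ℝ := fun j =>
    a j ∘ₗ LinearMap.fst ℝ V ℝ - s j • LinearMap.snd ℝ V ℝ
  let φ : V × ℝ →ₗ[ℝ] ℝ := v • LinearMap.snd ℝ V ℝ - L ∘ₗ LinearMap.fst ℝ V ℝ
  let W : Submodule ℝ (V × ℝ) := ⨅ j, LinearMap.ker (b j)
  have hW : ∀ q : V × ℝ, q ∈ W ↔ ∀ j, a j q.1 = s j * q.2 := fun q => by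
    simp [W, b, Submodule.mem_iInf, sub_eq_zero]
  obtain ⟨g, hgφ, hg⟩ := riesz_extension (K.prod (PointedCone.positive ℝ ℝ))
    ⟨W, φ.domRestrict W⟩ (by
      rintro ⟨⟨z, t⟩, hq⟩ ⟨hz, ht⟩
      have ht' : 0 ≤ t := by simpa using ht
      have hq' := (hW _).1 hq
      simp only at hq' hz
      change 0 ≤ v * t - L z
      rcases ht'.eq_or_lt with rfl | ht0
      -- Here `z` is a recession direction. If `L z > 0`, moving far enough from `z₀` gives the
      -- value `v + 1`.
      · by_contra! hneg
        have hL : 0 < L z := by linarith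
        have h0 := hv z₀ hz₀ ha
        have h1 := hv (z₀ + ((v - L z₀ + 1) / L z) • z)
          (K.add_mem hz₀ (hsmul (by apply div_nonneg <;> linarith) hz))
          (fun j => by simp [ha, hq' j])
        rw [map_add, map_smul, smul_eq_mul, div_mul_cancel₀ _ hL.ne'] at h1
        linarith
      · have h1 := hv (t⁻¹ • z) (hsmul (by positivity) hz)
          (fun j => by rw [map_smul, hq' j, smul_eq_mul]; field_simp)
        rw [map_smul, smul_eq_mul, inv_mul_le_iff₀ ht0] at h1
        linarith)
    (by
      rintro ⟨z, t⟩
      obtain ⟨N, hN, hNz⟩ := hint z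
      refine ⟨⟨(N + |t|) • (z₀, 1), W.smul_mem _ ((hW _).2 fun j => by simp [ha])⟩, ?_, ?_⟩
      · have : (N + |t|) • z₀ + z = |t| • z₀ + (N • z₀ + z) := by module
        simpa [this] using K.add_mem (hsmul (abs_nonneg t) hz₀) hNz
      · have := neg_abs_le t
        simp only [Prod.smul_mk, Prod.mk_add_mk, smul_eq_mul, mul_one]
        change 0 ≤ N + |t| + t
        linarith)
  -- Since `g - φ` vanishes on `W`, it is a combination of the `b j`; its values at `(z, 0)` and
  -- `(0, 1)` give the two claims.
  have hker : W ≤ LinearMap.ker (g - φ) := fun q hq => by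
    have := hgφ ⟨q, hq⟩
    simpa [sub_eq_zero] using this
  obtain ⟨c, hc⟩ := (Submodule.mem_span_range_iff_exists_fun ℝ).1
    (mem_span_of_iInf_ker_le_ker hker)
  refine ⟨-c, fun z hz => ?_, ?_⟩
  · have h1 := LinearMap.congr_fun hc (z, 0)
    have h2 : 0 ≤ g (z, 0) := hg _ ⟨hz, by simp⟩
    simp [b, φ] at h1
    simp [h1, h2]
  · have h1 := LinearMap.congr_fun hc (0, 1)
    have h2 : 0 ≤ g (0, 1) := hg _ ⟨K.zero_mem, by simp⟩
    simp [b, φ] at h1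
    simp
    linarith

/-! ### The `2n + 1` quadratics treated as one family of blocks -/

/-- The coefficients `(M, v, c)` of a quadratic function `xᵀ M x + xᵀ v + c`. -/
abbrev Block (n : ℕ) : Type := Matrix (Fin n) (Fin n) ℝ × (Fin n → ℝ) × ℝ

/-- The indices of the quadratic functions `pᵢ`, `qᵢ` and `β` of a decomposition. -/
abbrev Idx (n : ℕ) : Type := Fin n ⊕ Fin n ⊕ Unit

variable {n m : ℕ}

/-- The quadratic functions of a decomposition as a family. -/
def Coeffs.blocks (Z : Coeffs n) : Idx n → Block n :=
  Sum.elim (fun i => (Z.P i, Z.r i, Z.w i))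
    (Sum.elim (fun i => (Z.Q i, Z.f i, Z.g i)) fun _ => (Z.P', Z.r', Z.w'))

/-- The decomposition with a given family of quadratic functions. -/
def Coeffs.ofBlocks (z : Idx n → Block n) : Coeffs n where
  P i := (z (.inl i)).1
  r i := (z (.inl i)).2.1
  w i := (z (.inl i)).2.2
  Q i := (z (.inr (.inl i))).1
  f i := (z (.inr (.inl i))).2.1
  g i := (z (.inr (.inl i))).2.2
  P' := (z (.inr (.inr ()))).1
  r' := (z (.inr (.inr ()))).2.1
  w' := (z (.inr (.inr ()))).2.2

theorem Coeffs.blocks_ofBlocks (z : Idx n → Block n) : (Coeffs.ofBlocks z).blocks = z := by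
  ext1 k
  rcases k with i | i | i <;> rfl

/-- The coefficients of the `j`-th equation as a family. -/
def EqSystem.blocks (D : EqSystem n m) (j : Fin m) : Idx n → Block n :=
  Sum.elim (fun i => (D.A j i, D.c j i, D.μ j i))
    (Sum.elim (fun i => (D.B j i, D.d j i, D.ν j i)) fun _ => (D.Ξ j, D.ω j, D.γ j))

/-- The vectors `Uᵢ`, `x - Uᵢ` and `x`. -/
def blockVec (x : Fin n → ℝ) (U : Matrix (Fin n) (Fin n) ℝ) : Idx n → Fin n → ℝ :=
  Sum.elim (fun i => U i) (Sum.elim (fun i => x - U i) fun _ => x)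

/-- The weights `xᵢ`, `1 - xᵢ` and `1`. -/
def blockWeight (x : Fin n → ℝ) : Idx n → ℝ :=
  Sum.elim x (Sum.elim (fun i => 1 - x i) fun _ => 1)

/-- The matrices `Yⁱ`, `Rⁱ` and `Yⁿ⁺¹`. -/
def SDPVar.blocks (v : SDPVar n m) : Idx n → Matrix (Fin n) (Fin n) ℝ :=
  Sum.elim (fun i => v.Y i.castSucc) (Sum.elim v.R fun _ => v.Y (Fin.last n))

/-- The pairs `(Uᵢ, xᵢ)`, `(x - Uᵢ, 1 - xᵢ)` and `(x, 1)` enter the program in the same way, so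
later arguments treat one block at a time. -/
theorem sdpFeasible_iff (D : EqSystem n m)
    (Xbar : Set ((Fin n → ℝ) × Matrix (Fin n) (Fin n) ℝ)) (v : SDPVar n m) :
    SDPFeasible D Xbar v ↔ (v.x, v.U) ∈ Xbar ∧ ∀ k,
      (-(v.blocks k + ∑ j, v.lam j • (D.blocks j k).1)).PosSemidef ∧
      blockVec v.x v.U k + ∑ j, v.lam j • (D.blocks j k).2.1 = 0 ∧
      blockWeight v.x k + ∑ j, v.lam j * (D.blocks j k).2.2 = 0 ∧
      (bordered (v.blocks k) (blockVec v.x v.U k) (blockWeight v.x k)).PosSemidef := by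
  constructor
  · intro h
    refine ⟨h.mem, ?_⟩
    rintro (i | i | i)
    · exact ⟨h.lmi_A i, h.eq_c i, h.eq_μ i, h.lmi_Y i⟩
    · exact ⟨h.lmi_B i, h.eq_d i, h.eq_ν i, h.lmi_R i⟩
    · exact ⟨h.lmi_Ξ, h.eq_ω, h.eq_γ, h.lmi_Y_last⟩
  · rintro ⟨hmem, h⟩
    exact
      { lmi_A := fun i => (h (.inl i)).1
        lmi_B := fun i => (h (.inr (.inl i))).1
        lmi_Ξ := (h (.inr (.inr ()))).1
        eq_c := fun i => (h (.inl i)).2.1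
        eq_d := fun i => (h (.inr (.inl i))).2.1
        eq_ω := (h (.inr (.inr ()))).2.1
        eq_μ := fun i => (h (.inl i)).2.2.1
        eq_ν := fun i => (h (.inr (.inl i))).2.2.1
        eq_γ := (h (.inr (.inr ()))).2.2.1
        lmi_Y := fun i => (h (.inl i)).2.2.2
        lmi_R := fun i => (h (.inr (.inl i))).2.2.2
        lmi_Y_last := (h (.inr (.inr ()))).2.2.2
        mem := hmem }

/-- The inner product of two blocks, as a linear function of the second one. -/
def pairing (S : Block n) : Block n →ₗ[ℝ] ℝ where
  toFun T := matInner S.1 T.1 + S.2.1 ⬝ᵥ T.2.1 + S.2.2 * T.2.2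
  map_add' T T' := by
    simp only [matInner, Prod.fst_add, Prod.snd_add, Matrix.mul_add, trace_add, dotProduct_add]
    ring
  map_smul' c T := by
    simp only [matInner, Prod.smul_fst, Prod.smul_snd, Matrix.mul_smul, trace_smul,
      dotProduct_smul, smul_eq_mul, RingHom.id_apply]
    ring

theorem pairing_apply (S T : Block n) :
    pairing S T = matInner S.1 T.1 + S.2.1 ⬝ᵥ T.2.1 + S.2.2 * T.2.2 := rfl

/-- The perspective of a quadratic function, as a linear function of its coefficients. -/
def perspective (u : Fin n → ℝ) (t : ℝ) : Block n →ₗ[ℝ] ℝ where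
  toFun T := 1 / t * (u ⬝ᵥ (T.1 *ᵥ u)) + u ⬝ᵥ T.2.1 + t * T.2.2
  map_add' T T' := by
    simp only [Prod.fst_add, Prod.snd_add, add_mulVec, dotProduct_add]
    ring
  map_smul' c T := by
    simp only [Prod.smul_fst, Prod.smul_snd, smul_mulVec, dotProduct_smul, smul_eq_mul,
      RingHom.id_apply]
    ring

theorem perspective_apply (u : Fin n → ℝ) (t : ℝ) (T : Block n) :
    perspective u t T = 1 / t * (u ⬝ᵥ (T.1 *ᵥ u)) + u ⬝ᵥ T.2.1 + t * T.2.2 := rfl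

theorem perspective_smul (x : Fin n → ℝ) (t : ℝ) (T : Block n) :
    perspective (t • x) t T = t * quadratic T.1 T.2.1 T.2.2 x := by
  rcases eq_or_ne t 0 with rfl | ht
  · simp [perspective_apply]
  · simp only [perspective_apply, quadratic, mulVec_smul, dotProduct_smul, smul_dotProduct,
      smul_eq_mul]
    field_simp

/-- The left-hand side of the `j`-th equation as a linear function. -/
def EqSystem.lhsLin (D : EqSystem n m) (j : Fin m) : (Idx n → Block n) →ₗ[ℝ] ℝ :=
  ∑ k, pairing (D.blocks j k) ∘ₗ LinearMap.proj k

theorem EqSystem.lhsLin_apply (D : EqSystem n m) (j : Fin m) (z : Idx n → Block n) :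
    D.lhsLin j z = ∑ k, pairing (D.blocks j k) (z k) := by
  simp [EqSystem.lhsLin]

theorem EqSystem.lhs_eq (D : EqSystem n m) (j : Fin m) (Z : Coeffs n) :
    D.lhs j Z = D.lhsLin j Z.blocks := by
  simp only [EqSystem.lhsLin_apply, Fintype.sum_sum_type, EqSystem.lhs, EqSystem.blocks,
    Coeffs.blocks, Sum.elim_inl, Sum.elim_inr, pairing_apply, Finset.univ_unique,
    Finset.sum_singleton, Finset.sum_add_distrib]
  ring

/-- The finite values of `g₃ x U`, as a linear function of the coefficients. -/
def g₃Lin (x : Fin n → ℝ) (U : Matrix (Fin n) (Fin n) ℝ) : (Idx n → Block n) →ₗ[ℝ] ℝ :=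
  ∑ k, perspective (blockVec x U k) (blockWeight x k) ∘ₗ LinearMap.proj k

theorem g₃Lin_apply (x : Fin n → ℝ) (U : Matrix (Fin n) (Fin n) ℝ) (z : Idx n → Block n) :
    g₃Lin x U z = ∑ k, perspective (blockVec x U k) (blockWeight x k) (z k) := by
  simp [g₃Lin]

/-- The relaxation is exact at `U = x xᵀ`, where each block vector is its weight times `x`.
Coefficient matching thereby becomes a condition on `g₃Lin`. -/
theorem toFun_eq (Z : Coeffs n) (x : Fin n → ℝ) :
    Z.toFun x = g₃Lin x (vecMulVec x x) Z.blocks := by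
  have h : ∀ k, blockVec x (vecMulVec x x) k = blockWeight x k • x := by
    rintro (i | i | i) <;> ext l <;>
      simp [blockVec, blockWeight, vecMulVec_apply, sub_mul]
  simp only [g₃Lin_apply, h, perspective_smul]
  simp only [Fintype.sum_sum_type, Coeffs.toFun, blockWeight,
    Coeffs.blocks, Sum.elim_inl, Sum.elim_inr, Finset.univ_unique,
    Finset.sum_singleton, one_mul]
  ring

/-! ### Finite and infinite values of `g₃` -/

/-- `g₃` avoids the value `+∞` from a division by zero. -/
def Nondegenerate (x : Fin n → ℝ) (U : Matrix (Fin n) (Fin n) ℝ) : Prop :=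
  ∀ k, blockWeight x k = 0 → blockVec x U k = 0

/-- At `t = 0` the default `1 / 0 = 0` agrees with the convention because `u = 0`. -/
theorem quadOverLin_eq_coe (M : Matrix (Fin n) (Fin n) ℝ) {u : Fin n → ℝ} {t : ℝ}
    (h : t = 0 → u = 0) : quadOverLin M u t = ((1 / t * (u ⬝ᵥ (M *ᵥ u)) : ℝ) : EReal) := by
  by_cases ht : t = 0
  · simp [quadOverLin, ht, h ht]
  · simp [quadOverLin, ht]

theorem coe_sum_ereal {ι : Type*} (S : Finset ι) (f : ι → ℝ) :
    ((∑ i ∈ S, f i : ℝ) : EReal) = ∑ i ∈ S, (f i : EReal) := by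
  classical
  induction S using Finset.induction_on with
  | empty => simp
  | insert a S ha ih => rw [Finset.sum_insert ha, Finset.sum_insert ha, EReal.coe_add, ih]

theorem g₃_eq_coe {x : Fin n → ℝ} {U : Matrix (Fin n) (Fin n) ℝ} (h : Nondegenerate x U)
    (Z : Coeffs n) : g₃ x U Z = (g₃Lin x U Z.blocks : EReal) := by
  have h1 : ∀ i, quadOverLin (Z.P i) (U i) (x i) = _ :=
    fun i => quadOverLin_eq_coe (Z.P i) (h (.inl i))
  have h2 : ∀ i, quadOverLin (Z.Q i) (x - U i) (1 - x i) = _ :=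
    fun i => quadOverLin_eq_coe (Z.Q i) (h (.inr (.inl i)))
  simp only [g₃, h1, h2, ← EReal.coe_add, ← coe_sum_ereal]
  congr 1
  simp only [g₃Lin_apply, Fintype.sum_sum_type, blockVec, blockWeight,
    Coeffs.blocks, Sum.elim_inl, Sum.elim_inr, perspective_apply, Finset.univ_unique,
    Finset.sum_singleton, Finset.sum_add_distrib, mul_comm (Z.w _)]
  ring

theorem quadOverLin_ne_bot (M : Matrix (Fin n) (Fin n) ℝ) (u : Fin n → ℝ) (t : ℝ) :
    quadOverLin M u t ≠ ⊥ := by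
  unfold quadOverLin
  split_ifs
  · simp
  · simp
  · exact EReal.coe_ne_bot _

theorem quadOverLin_eq_top {M : Matrix (Fin n) (Fin n) ℝ} {u : Fin n → ℝ} {t : ℝ} (ht : t = 0)
    (hu : u ⬝ᵥ (M *ᵥ u) ≠ 0) : quadOverLin M u t = ⊤ := by
  rw [quadOverLin, if_pos ht, if_neg hu]

theorem sum_ne_bot_ereal {ι : Type*} (S : Finset ι) {f : ι → EReal} (hf : ∀ i, f i ≠ ⊥) :
    ∑ i ∈ S, f i ≠ ⊥ := by
  classical
  induction S using Finset.induction_on with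
  | empty => simp
  | insert a S ha ih => rw [Finset.sum_insert ha]; exact EReal.add_ne_bot_iff.2 ⟨hf a, ih⟩

/-- One summand is `⊤` by strict convexity. In `EReal`, `⊤ + ⊥ = ⊥`, so the other summands must be
shown to differ from `⊥`. -/
theorem g₃_eq_top {x : Fin n → ℝ} {U : Matrix (Fin n) (Fin n) ℝ} (h : ¬ Nondegenerate x U)
    {Z : Coeffs n} (hZ : ∀ k, ∀ u, u ≠ 0 → 0 < u ⬝ᵥ ((Z.blocks k).1 *ᵥ u)) : g₃ x U Z = ⊤ := by
  obtain ⟨k, hk, hk'⟩ : ∃ k, blockWeight x k = 0 ∧ blockVec x U k ≠ 0 := by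
    unfold Nondegenerate at h
    push Not at h
    exact h
  have hpos := (hZ k _ hk').ne'
  have hterm : ∀ i, quadOverLin (Z.P i) (U i) (x i)
      + ((U i ⬝ᵥ Z.r i + Z.w i * x i : ℝ) : EReal)
      + quadOverLin (Z.Q i) (x - U i) (1 - x i)
      + (((x - U i) ⬝ᵥ Z.f i + (1 - x i) * Z.g i : ℝ) : EReal) ≠ ⊥ := fun i => by
    simp only [EReal.add_ne_bot_iff]
    exact ⟨⟨⟨quadOverLin_ne_bot _ _ _, EReal.coe_ne_bot _⟩, quadOverLin_ne_bot _ _ _⟩,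
      EReal.coe_ne_bot _⟩
  have main : ∀ i, quadOverLin (Z.P i) (U i) (x i) = ⊤ ∨
      quadOverLin (Z.Q i) (x - U i) (1 - x i) = ⊤ → g₃ x U Z = ⊤ := by
    intro i hi
    unfold g₃
    rw [← Finset.add_sum_erase _ _ (Finset.mem_univ i)]
    have htop : quadOverLin (Z.P i) (U i) (x i)
      + ((U i ⬝ᵥ Z.r i + Z.w i * x i : ℝ) : EReal)
      + quadOverLin (Z.Q i) (x - U i) (1 - x i)
      + (((x - U i) ⬝ᵥ Z.f i + (1 - x i) * Z.g i : ℝ) : EReal) = ⊤ := by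
      rcases hi with hi | hi
      · rw [hi, EReal.top_add_of_ne_bot (EReal.coe_ne_bot _),
          EReal.top_add_of_ne_bot (quadOverLin_ne_bot _ _ _),
          EReal.top_add_of_ne_bot (EReal.coe_ne_bot _)]
      · rw [hi, EReal.add_top_of_ne_bot
          (EReal.add_ne_bot_iff.2 ⟨quadOverLin_ne_bot _ _ _, EReal.coe_ne_bot _⟩),
          EReal.top_add_of_ne_bot (EReal.coe_ne_bot _)]
    rw [htop, EReal.top_add_of_ne_bot (sum_ne_bot_ereal _ hterm),
      EReal.top_add_of_ne_bot (EReal.coe_ne_bot _)]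
  rcases k with i | i | i
  · exact main i (.inl (quadOverLin_eq_top hk hpos))
  · exact main i (.inr (quadOverLin_eq_top hk hpos))
  · simp [blockWeight] at hk

/-! ### Symmetrization and the cone of convex families -/

/-- The family with symmetrized matrices. -/
def symmetrize (z : Idx n → Block n) (k : Idx n) : Block n :=
  ((1 / 2 : ℝ) • ((z k).1 + (z k).1ᵀ), (z k).2)

theorem dotProduct_transpose_mulVec_self (M : Matrix (Fin n) (Fin n) ℝ) (u : Fin n → ℝ) :
    u ⬝ᵥ (Mᵀ *ᵥ u) = u ⬝ᵥ (M *ᵥ u) := by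
  rw [mulVec_transpose, dotProduct_comm, dotProduct_mulVec]

theorem symmetrize_quad (z : Idx n → Block n) (k : Idx n) (u : Fin n → ℝ) :
    u ⬝ᵥ ((symmetrize z k).1 *ᵥ u) = u ⬝ᵥ ((z k).1 *ᵥ u) := by
  simp only [symmetrize, smul_mulVec, add_mulVec, dotProduct_smul, dotProduct_add,
    dotProduct_transpose_mulVec_self, smul_eq_mul]
  ring

theorem g₃Lin_symmetrize (x : Fin n → ℝ) (U : Matrix (Fin n) (Fin n) ℝ) (z : Idx n → Block n) :
    g₃Lin x U (symmetrize z) = g₃Lin x U z := by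
  simp only [g₃Lin_apply, perspective_apply, symmetrize_quad]
  rfl

/-- The families of quadratic functions that are convex. -/
def convexCone (n : ℕ) : PointedCone ℝ (Idx n → Block n) where
  -- Symmetry is not required: symmetric matrices form a proper subspace when `n ≥ 2`, and the cone
  -- would then have no interior point in the space of all families.
  carrier := {z | ∀ k u, 0 ≤ u ⬝ᵥ ((z k).1 *ᵥ u)}
  add_mem' {z z'} hz hz' k u := by
    simpa [add_mulVec, dotProduct_add] using add_nonneg (hz k u) (hz' k u)
  zero_mem' k u := by simp
  smul_mem' c z hz k u := by
    have h : ((c • z) k).1 = (c : ℝ) • (z k).1 := rfl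
    rw [h, smul_mulVec, dotProduct_smul]
    exact mul_nonneg c.2 (hz k u)

theorem EqSystem.Matches.solves_ofBlocks {D : EqSystem n m} {p : MvPolynomial (Fin n) ℝ}
    (hD : D.Matches p) (z : Idx n → Block n) :
    (∀ j, D.lhsLin j z = D.s j) ↔
      ∀ x, g₃Lin x (vecMulVec x x) z = MvPolynomial.eval x p := by
  have := hD.solves_iff (Coeffs.ofBlocks z)
  simpa only [EqSystem.Solves, EqSystem.lhs_eq, toFun_eq, Coeffs.blocks_ofBlocks] using this

/-- Solving the system depends only on the polynomial function, hence only on the quadratic forms,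
which symmetrization preserves. -/
theorem EqSystem.Matches.symmetrize_mem {D : EqSystem n m} {p : MvPolynomial (Fin n) ℝ}
    (hD : D.Matches p) {z : Idx n → Block n} (hz : z ∈ convexCone n)
    (hs : ∀ j, D.lhsLin j z = D.s j) : Coeffs.ofBlocks (symmetrize z) ∈ D.feasibleCoeffs := by
  have hpsd : ∀ k, (symmetrize z k).1.PosSemidef := fun k => by
    refine PosSemidef.of_dotProduct_mulVec_nonneg ?_ fun u => ?_
    · simp [IsHermitian, symmetrize, add_comm]
    · simpa only [star_trivial, symmetrize_quad] using hz k u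
  refine ⟨fun j => ?_, fun i => hpsd _, fun i => hpsd _, hpsd _⟩
  rw [EqSystem.lhs_eq, Coeffs.blocks_ofBlocks]
  revert j
  rw [hD.solves_ofBlocks] at hs ⊢
  simpa only [g₃Lin_symmetrize] using hs

/-! ### The Slater point -/

/-- Degrees 0 and 1 go into `β`; degrees 2 and 3 become `xᵢ` times a linear or quadratic `pᵢ`.
Convexity is not needed yet. -/
theorem exists_toFun_eq_monomial (d : Fin n →₀ ℕ) (c : ℝ) (hd : (d.sum fun _ e => e) ≤ 3) :
    ∃ Z : Coeffs n, ∀ x, Z.toFun x = MvPolynomial.eval x (MvPolynomial.monomial d c) := by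
  have heval : ∀ x : Fin n → ℝ, MvPolynomial.eval x (MvPolynomial.monomial d c) =
      c * ((Finsupp.toMultiset d).map x).prod := fun x => by
    rw [MvPolynomial.eval_monomial, Finsupp.toMultiset_map, Finsupp.prod_toMultiset,
      Finsupp.prod_mapDomain_index (by simp) (by intros; rw [pow_add])]
  have hcard : Multiset.card (Finsupp.toMultiset d) ≤ 3 := by
    rw [Finsupp.card_toMultiset]; exact hd
  simp only [heval]
  generalize Finsupp.toMultiset d = S at hcard
  let Z₀ : Coeffs n := ⟨0, 0, 0, 0, 0, 0, 0, 0, 0⟩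
  obtain h | h | h | h : Multiset.card S = 0 ∨ Multiset.card S = 1 ∨ Multiset.card S = 2 ∨
      Multiset.card S = 3 := by omega
  · obtain rfl := Multiset.card_eq_zero.1 h
    exact ⟨{ Z₀ with w' := c }, fun x => by simp [Z₀, Coeffs.toFun, quadratic]⟩
  · obtain ⟨i, rfl⟩ := Multiset.card_eq_one.1 h
    exact ⟨{ Z₀ with r' := Pi.single i c }, fun x => by
      simp [Z₀, Coeffs.toFun, quadratic, mul_comm]⟩
  · obtain ⟨i, j, rfl⟩ := Multiset.card_eq_two.1 h
    refine ⟨{ Z₀ with r := Pi.single i (Pi.single j c) }, fun x => ?_⟩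
    have h : ∀ l, x l * (x ⬝ᵥ (Pi.single i (Pi.single j c) : Fin n → Fin n → ℝ) l) =
        if l = i then x i * (x j * c) else 0 := fun l => by
      by_cases hl : l = i
      · subst hl; simp
      · simp [hl]
    simp [Z₀, Coeffs.toFun, quadratic, h]
    ring
  · obtain ⟨i, j, k, rfl⟩ := Multiset.card_eq_three.1 h
    refine ⟨{ Z₀ with P := Pi.single i (Matrix.single j k c) }, fun x => ?_⟩
    have h : ∀ l, x l * (x ⬝ᵥ ((Pi.single i (Matrix.single j k c) :
        Fin n → Matrix (Fin n) (Fin n) ℝ) l *ᵥ x)) =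
        if l = i then x i * (x j * (c * x k)) else 0 := fun l => by
      by_cases hl : l = i
      · subst hl; simp [single_mulVec_eq]; left; ring
      · simp [hl]
    simp [Z₀, Coeffs.toFun, quadratic, h]
    ring

/-- Every polynomial of degree at most three is a sum of linear times quadratic functions. -/
theorem exists_blocks_eq {p : MvPolynomial (Fin n) ℝ} (hp : p.totalDegree ≤ 3) :
    ∃ z : Idx n → Block n, ∀ x, g₃Lin x (vecMulVec x x) z = MvPolynomial.eval x p := by
  have h : ∀ d : Fin n →₀ ℕ, ∃ Z : Coeffs n, d ∈ p.support → ∀ x,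
      Z.toFun x = MvPolynomial.eval x (MvPolynomial.monomial d (p.coeff d)) := fun d => by
    by_cases hd : d ∈ p.support
    · obtain ⟨Z, hZ⟩ := exists_toFun_eq_monomial d (p.coeff d)
        ((MvPolynomial.le_totalDegree hd).trans hp)
      exact ⟨Z, fun _ => hZ⟩
    · exact ⟨Coeffs.ofBlocks 0, fun h => absurd h hd⟩
  choose Z hZ using h
  refine ⟨∑ d ∈ p.support, (Z d).blocks, fun x => ?_⟩
  rw [map_sum]
  conv_rhs => rw [p.as_sum, map_sum]
  exact Finset.sum_congr rfl fun d hd => by rw [← toFun_eq, hZ d hd]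

theorem dotProduct_self_nonneg (u : Fin n → ℝ) : 0 ≤ u ⬝ᵥ u := by
  simpa using dotProduct_self_star_nonneg u

theorem abs_quad_le (M : Matrix (Fin n) (Fin n) ℝ) (u : Fin n → ℝ) :
    |u ⬝ᵥ (M *ᵥ u)| ≤ (∑ i, ∑ j, |M i j|) * (u ⬝ᵥ u) := by
  have hsq : ∀ i, u i ^ 2 ≤ u ⬝ᵥ u := fun i => by
    have := Finset.single_le_sum (f := fun i => u i * u i) (fun i _ => mul_self_nonneg (u i))
      (Finset.mem_univ i)
    simpa [dotProduct, sq] using this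
  have hsum : u ⬝ᵥ (M *ᵥ u) = ∑ i, ∑ j, u i * (M i j * u j) := by
    simp only [dotProduct, mulVec, Finset.mul_sum]
  simp only [hsum, Finset.sum_mul]
  refine (Finset.abs_sum_le_sum_abs _ _).trans (Finset.sum_le_sum fun i _ => ?_)
  refine (Finset.abs_sum_le_sum_abs _ _).trans (Finset.sum_le_sum fun j _ => ?_)
  rw [abs_mul, abs_mul, mul_left_comm]
  refine mul_le_mul_of_nonneg_left ?_ (abs_nonneg _)
  nlinarith [hsq i, hsq j, sq_nonneg (|u i| - |u j|), sq_abs (u i), sq_abs (u j)]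

/-- The quadratic forms of a family are bounded below by a common multiple of `-‖u‖²`. -/
theorem exists_quad_bound (z : Idx n → Block n) :
    ∃ N : ℝ, 0 ≤ N ∧ ∀ k u, 0 ≤ N * (u ⬝ᵥ u) + u ⬝ᵥ ((z k).1 *ᵥ u) := by
  refine ⟨∑ k, ∑ i, ∑ j, |(z k).1 i j|, by positivity, fun k u => ?_⟩
  have h1 := abs_quad_le (z k).1 u
  have h2 : ∑ i, ∑ j, |(z k).1 i j| ≤ ∑ k, ∑ i, ∑ j, |(z k).1 i j| :=
    Finset.single_le_sum (f := fun k => ∑ i, ∑ j, |(z k).1 i j|) (fun k _ => by positivity)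
      (Finset.mem_univ k)
  have h3 := mul_le_mul_of_nonneg_right h2 (dotProduct_self_nonneg u)
  linarith [neg_abs_le (u ⬝ᵥ ((z k).1 *ᵥ u))]

/-- A decomposition of the zero polynomial whose quadratic forms are all `‖u‖²`. -/
def zeroDecomposition (n : ℕ) : Coeffs n where
  P _ := 1
  r i := Pi.single i (-(n + 1 : ℝ))
  w _ := 0
  Q _ := 1
  f _ := 0
  g _ := 0
  P' := 1
  r' := 0
  w' := 0

/-- The cubic terms of the `pᵢ` and `qᵢ` parts cancel. What remains is `n‖x‖²` from the `qᵢ` and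
`‖x‖²` from `β`, removed by the coefficient `-(n + 1)` in `r`. -/
theorem zeroDecomposition_toFun (x : Fin n → ℝ) : (zeroDecomposition n).toFun x = 0 := by
  have h : ∀ r : ℝ, x ⬝ᵥ x * r = ∑ i, x i * (x i * r) := fun r => by
    simp only [dotProduct, Finset.sum_mul, mul_assoc]
  have h' : ∑ i, x i * (x ⬝ᵥ x) = ∑ i, x ⬝ᵥ x * x i :=
    Finset.sum_congr rfl fun i _ => mul_comm _ _
  simp [Coeffs.toFun, zeroDecomposition, quadratic, mul_add, sub_mul, Finset.sum_add_distrib,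
    Finset.sum_sub_distrib, -neg_add_rev]
  rw [mul_comm (n : ℝ), h n, h']
  have := h 1
  simp only [mul_one] at this
  rw [this]
  ring

theorem zeroDecomposition_blocks_fst (k : Idx n) : ((zeroDecomposition n).blocks k).1 = 1 := by
  rcases k with i | i | i <;> rfl

/-- The Slater condition: decompositions into strictly convex quadratic functions exist. -/
theorem exists_strictly_convex_blocks {p : MvPolynomial (Fin n) ℝ} (hp : p.totalDegree ≤ 3) :
    ∃ z : Idx n → Block n, (∀ x, g₃Lin x (vecMulVec x x) z = MvPolynomial.eval x p) ∧
      ∀ k u, u ⬝ᵥ u ≤ u ⬝ᵥ ((z k).1 *ᵥ u) := by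
  obtain ⟨z, hz⟩ := exists_blocks_eq hp
  obtain ⟨N, hN, hNz⟩ := exists_quad_bound z
  refine ⟨z + (N + 1) • (zeroDecomposition n).blocks, fun x => ?_, fun k u => ?_⟩
  · rw [map_add, map_smul, ← toFun_eq, zeroDecomposition_toFun, hz]
    simp
  · have := hNz k u
    simp only [Pi.add_apply, Pi.smul_apply, Prod.fst_add, Prod.smul_fst,
      zeroDecomposition_blocks_fst, add_mulVec, smul_mulVec, one_mulVec, dotProduct_add,
      dotProduct_smul, smul_eq_mul]
    linarith

/-! ### Bordered matrices and Schur complements -/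

/-- For `t ≠ 0` the matrix is the rank-one `(u, t)(u, t)ᵀ / t`; for `t = 0` it vanishes. -/
theorem bordered_posSemidef (u : Fin n → ℝ) {t : ℝ} (ht : 0 ≤ t) (h : t = 0 → u = 0) :
    (bordered ((1 / t) • vecMulVec u u) u t).PosSemidef := by
  have : bordered ((1 / t) • vecMulVec u u) u t =
      (1 / t) • vecMulVec (Sum.elim u fun _ => t) (star (Sum.elim u fun _ => t)) := by
    by_cases ht0 : t = 0
    · obtain rfl := h ht0
      ext (i | i) (j | j) <;> simp [bordered, ht0]
    · ext (i | i) (j | j) <;> simp [bordered, vecMulVec_apply] <;> field_simp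
  rw [this]
  exact (posSemidef_vecMulVec_self_star _).smul (by positivity)

theorem bordered_quad (Y : Matrix (Fin n) (Fin n) ℝ) (u y : Fin n → ℝ) (t a : ℝ) :
    Sum.elim y (fun _ => a) ⬝ᵥ (bordered Y u t *ᵥ Sum.elim y fun _ => a) =
      y ⬝ᵥ (Y *ᵥ y) + 2 * a * (u ⬝ᵥ y) + t * a ^ 2 := by
  have h : bordered Y u t *ᵥ Sum.elim y (fun _ => a) =
      Sum.elim (Y *ᵥ y + a • u) fun _ => u ⬝ᵥ y + t * a := by
    rw [bordered, fromBlocks_mulVec]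
    ext (i | i) <;> simp [mulVec, dotProduct, mul_comm]
  rw [h, sumElim_dotProduct_sumElim, dotProduct_add, dotProduct_smul, dotProduct_comm y u]
  simp [dotProduct]
  ring

theorem bordered_psd_quad {Y : Matrix (Fin n) (Fin n) ℝ} {u : Fin n → ℝ} {t : ℝ}
    (h : (bordered Y u t).PosSemidef) (y : Fin n → ℝ) (a : ℝ) :
    0 ≤ y ⬝ᵥ (Y *ᵥ y) + 2 * a * (u ⬝ᵥ y) + t * a ^ 2 := by
  simpa only [star_trivial, bordered_quad] using
    h.dotProduct_mulVec_nonneg (Sum.elim y fun _ => a)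

theorem bordered_eq_zero {Y : Matrix (Fin n) (Fin n) ℝ} {u : Fin n → ℝ} {t : ℝ}
    (h : (bordered Y u t).PosSemidef) (ht : t = 0) : u = 0 := by
  by_contra hu
  have hpos : 0 < u ⬝ᵥ u := (dotProduct_self_nonneg u).lt_of_ne'
    (by simpa using hu)
  -- This last coordinate makes the quadratic form equal to `-1` when `t = 0`.
  have := bordered_psd_quad h u (-(u ⬝ᵥ (Y *ᵥ u) + 1) / (2 * (u ⬝ᵥ u)))
  have h2 : 2 * (-(u ⬝ᵥ (Y *ᵥ u) + 1) / (2 * (u ⬝ᵥ u))) * (u ⬝ᵥ u) = -(u ⬝ᵥ (Y *ᵥ u) + 1) := by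
    field_simp
  rw [h2, ht] at this
  linarith

theorem schur_posSemidef {Y : Matrix (Fin n) (Fin n) ℝ} {u : Fin n → ℝ} {t : ℝ}
    (h : (bordered Y u t).PosSemidef) : (Y - (1 / t) • vecMulVec u u).PosSemidef := by
  have hY : Y.IsHermitian := (isHermitian_fromBlocks_iff.1 h.1).1
  refine PosSemidef.of_dotProduct_mulVec_nonneg (hY.sub ?_) fun y => ?_
  · ext i j
    simp [vecMulVec_apply, mul_comm]
  · by_cases ht : t = 0
    · simpa [ht] using bordered_psd_quad h y 0
    -- The critical point in `a` of the bordered quadratic form.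
    · have := bordered_psd_quad h y (-(u ⬝ᵥ y) / t)
      simp only [star_trivial, sub_mulVec, smul_mulVec, vecMulVec_mulVec, dotProduct_sub,
        dotProduct_smul, op_smul_eq_smul, smul_eq_mul, dotProduct_comm y u]
      refine this.trans_eq ?_
      field_simp
      ring

-- With `B = Cᴴ C`, the inner product is the trace of `C A Cᴴ`.
open scoped MatrixOrder in
theorem matInner_nonneg {A B : Matrix (Fin n) (Fin n) ℝ} (hA : A.PosSemidef)
    (hB : B.PosSemidef) : 0 ≤ matInner A B := by
  obtain ⟨C, rfl⟩ : ∃ C : Matrix (Fin n) (Fin n) ℝ, B = Cᴴ * C := by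
    have h := (CFC.sqrt_nonneg B).posSemidef.1.eq
    exact ⟨CFC.sqrt B, by rw [h, CFC.sqrt_mul_sqrt_self B hB.nonneg]⟩
  rw [matInner, show Aᵀ = A by simpa using hA.1.eq, ← Matrix.mul_assoc, trace_mul_comm,
    ← Matrix.mul_assoc]
  exact (hA.mul_mul_conjTranspose_same C).trace_nonneg

theorem matInner_vecMulVec (A : Matrix (Fin n) (Fin n) ℝ) (u v : Fin n → ℝ) :
    matInner A (vecMulVec u v) = u ⬝ᵥ (A *ᵥ v) := by
  rw [matInner, mul_vecMulVec, trace_vecMulVec, mulVec_transpose, dotProduct_mulVec]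

theorem matInner_comm (A B : Matrix (Fin n) (Fin n) ℝ) : matInner A B = matInner B A := by
  rw [matInner, matInner, ← trace_transpose, transpose_mul, transpose_transpose]

theorem inv_mul_quad_le_matInner {Y M : Matrix (Fin n) (Fin n) ℝ} {u : Fin n → ℝ} {t : ℝ}
    (h : (bordered Y u t).PosSemidef) (hM : M.PosSemidef) :
    1 / t * (u ⬝ᵥ (M *ᵥ u)) ≤ matInner Y M := by
  have h1 := matInner_nonneg (schur_posSemidef h) hM
  rw [matInner_comm, matInner, mul_sub, Matrix.mul_smul, trace_sub, trace_smul, ← matInner, ← matInner,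
    matInner_vecMulVec, smul_eq_mul, matInner_comm] at h1
  linarith

theorem matInner_smul_left (c : ℝ) (A B : Matrix (Fin n) (Fin n) ℝ) :
    matInner (c • A) B = c * matInner A B := by
  simp [matInner]

theorem matInner_sum_left {ι : Type*} (S : Finset ι) (A : ι → Matrix (Fin n) (Fin n) ℝ)
    (B : Matrix (Fin n) (Fin n) ℝ) : matInner (∑ j ∈ S, A j) B = ∑ j ∈ S, matInner (A j) B := by
  simp [matInner, transpose_sum, Finset.sum_mul, trace_sum]

theorem Coeffs.blocks_posSemidef {D : EqSystem n m} {Z : Coeffs n} (hZ : Z ∈ D.feasibleCoeffs)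
    (k : Idx n) : (Z.blocks k).1.PosSemidef := by
  rcases k with i | i | i
  exacts [hZ.2.1 i, hZ.2.2.1 i, hZ.2.2.2]

/-! ### Weak and strong duality at a fixed `(x, U)` -/

/-- Weak duality. -/
theorem innerMax_le_sdpObjective {D : EqSystem n m}
    {Xbar : Set ((Fin n → ℝ) × Matrix (Fin n) (Fin n) ℝ)} {v : SDPVar n m}
    (hv : SDPFeasible D Xbar v) : innerMax D v.x v.U ≤ (sdpObjective D v : EReal) := by
  obtain ⟨-, hv⟩ := (sdpFeasible_iff D Xbar v).1 hv
  have hnd : Nondegenerate v.x v.U := fun k hk => bordered_eq_zero (hv k).2.2.2 hk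
  refine iSup₂_le fun Z hZ => ?_
  rw [g₃_eq_coe hnd, EReal.coe_le_coe_iff]
  have hterm : ∀ k, perspective (blockVec v.x v.U k) (blockWeight v.x k) (Z.blocks k) ≤
      -∑ j, v.lam j * pairing (D.blocks j k) (Z.blocks k) := fun k => by
    obtain ⟨h1, h2, h3, h4⟩ := hv k
    have hM := Coeffs.blocks_posSemidef hZ k
    have h5 := inv_mul_quad_le_matInner h4 hM
    have h6 := matInner_nonneg h1 hM
    rw [← neg_one_smul ℝ, matInner_smul_left, matInner, transpose_add, Matrix.add_mul, trace_add,
      ← matInner, ← matInner, matInner_sum_left] at h6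
    have h7 := congr_arg (· ⬝ᵥ (Z.blocks k).2.1) h2
    have h8 := congr_arg (· * (Z.blocks k).2.2) h3
    simp only [matInner_smul_left, add_dotProduct, sum_dotProduct, smul_dotProduct, smul_eq_mul,
      zero_dotProduct, add_mul, Finset.sum_mul, zero_mul, mul_assoc] at h6 h7 h8
    simp only [perspective_apply, pairing_apply, mul_add, Finset.sum_add_distrib]
    linarith
  calc g₃Lin v.x v.U Z.blocks
      ≤ ∑ k, -∑ j, v.lam j * pairing (D.blocks j k) (Z.blocks k) := by
        rw [g₃Lin_apply]
        exact Finset.sum_le_sum fun k _ => hterm k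
    _ = -∑ j, v.lam j * D.lhs j Z := by
        rw [Finset.sum_neg_distrib, Finset.sum_comm]
        simp only [← Finset.mul_sum, EqSystem.lhs_eq, EqSystem.lhsLin_apply]
    _ = sdpObjective D v := by
        simp only [hZ.1 _, sdpObjective]

theorem blockWeight_nonneg {x : Fin n → ℝ} (hx : ∀ i, 0 ≤ x i ∧ x i ≤ 1) (k : Idx n) :
    0 ≤ blockWeight x k := by
  rcases k with i | i | i
  exacts [(hx i).1, sub_nonneg.2 (hx i).2, zero_le_one]

/-- The `SDPVar` with prescribed matrices `Y`, `R`. -/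
def SDPVar.ofBlocks (x : Fin n → ℝ) (U : Matrix (Fin n) (Fin n) ℝ)
    (Y : Idx n → Matrix (Fin n) (Fin n) ℝ) (lam : Fin m → ℝ) : SDPVar n m :=
  ⟨x, U, Fin.snoc (fun i => Y (.inl i)) (Y (.inr (.inr ()))), fun i => Y (.inr (.inl i)), lam⟩

theorem SDPVar.blocks_ofBlocks (x : Fin n → ℝ) (U : Matrix (Fin n) (Fin n) ℝ)
    (Y : Idx n → Matrix (Fin n) (Fin n) ℝ) (lam : Fin m → ℝ) :
    (SDPVar.ofBlocks x U Y lam).blocks = Y := by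
  ext1 k
  rcases k with i | i | i <;> simp [SDPVar.ofBlocks, SDPVar.blocks]

/-- Strong duality, with dual attainment. -/
theorem exists_sdpFeasible_le_innerMax {p : MvPolynomial (Fin n) ℝ} (hp : p.totalDegree ≤ 3)
    {D : EqSystem n m} (hD : D.Matches p) {Xbar : Set ((Fin n → ℝ) × Matrix (Fin n) (Fin n) ℝ)}
    {x : Fin n → ℝ} {U : Matrix (Fin n) (Fin n) ℝ} (hxU : (x, U) ∈ Xbar)
    (hx : ∀ i, 0 ≤ x i ∧ x i ≤ 1) (hfin : innerMax D x U ≠ ⊤) :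
    ∃ Y R lam, SDPFeasible D Xbar ⟨x, U, Y, R, lam⟩ ∧
      (sdpObjective D ⟨x, U, Y, R, lam⟩ : EReal) ≤ innerMax D x U := by
  obtain ⟨z₀, hz₀p, hz₀⟩ := exists_strictly_convex_blocks hp
  have hz₀s := (hD.solves_ofBlocks z₀).2 hz₀p
  have hz₀K : z₀ ∈ convexCone n := fun k u => (dotProduct_self_nonneg u).trans (hz₀ k u)
  have hle : ∀ {z}, z ∈ convexCone n → (∀ j, D.lhsLin j z = D.s j) →
      g₃ x U (Coeffs.ofBlocks (symmetrize z)) ≤ innerMax D x U := fun {z} hz hs =>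
    le_iSup₂ (f := fun Z (_ : Z ∈ D.feasibleCoeffs) => g₃ x U Z) _ (hD.symmetrize_mem hz hs)
  have hnd : Nondegenerate x U := by
    by_contra hnd
    refine hfin (top_unique ((hle hz₀K hz₀s).trans' (g₃_eq_top hnd fun k u hu => ?_).ge))
    rw [Coeffs.blocks_ofBlocks, symmetrize_quad]
    refine ((dotProduct_self_nonneg u).lt_of_ne' ?_).trans_le (hz₀ k u)
    simpa using hu
  have hle' : ∀ {z}, z ∈ convexCone n → (∀ j, D.lhsLin j z = D.s j) →
      (g₃Lin x U z : EReal) ≤ innerMax D x U := fun {z} hz hs => by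
    have := hle hz hs
    rwa [g₃_eq_coe hnd, Coeffs.blocks_ofBlocks, g₃Lin_symmetrize] at this
  have hbot : innerMax D x U ≠ ⊥ := ((EReal.bot_lt_coe _).trans_le (hle' hz₀K hz₀s)).ne'
  lift innerMax D x U to ℝ using ⟨hfin, hbot⟩ with val
  obtain ⟨lam, hlam, hval⟩ := exists_dual_solution (convexCone n) D.lhsLin D.s (g₃Lin x U) hz₀K
    hz₀s (fun z => by
      obtain ⟨N, hN, hNz⟩ := exists_quad_bound z
      refine ⟨N, hN, fun k u => (hNz k u).trans ?_⟩
      simp only [Pi.add_apply, Pi.smul_apply, Prod.fst_add, Prod.smul_fst, add_mulVec,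
        smul_mulVec, dotProduct_add, dotProduct_smul, smul_eq_mul]
      have := mul_le_mul_of_nonneg_left (hz₀ k u) hN
      linarith)
    (fun z hz hs => EReal.coe_le_coe_iff.1 (hle' hz hs))
  -- Families supported on one block lie in the cone, so the dual inequality splits by blocks.
  have hblock : ∀ (k : Idx n) (T : Block n), (∀ u, 0 ≤ u ⬝ᵥ (T.1 *ᵥ u)) →
      perspective (blockVec x U k) (blockWeight x k) T
        + ∑ j, lam j * pairing (D.blocks j k) T ≤ 0 := fun k T hT => by
    have h := hlam (Pi.single k T) fun l u => by
      by_cases hl : l = k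
      · subst hl; simpa using hT u
      · simp [hl]
    have hs : ∀ f : Idx n → Block n →ₗ[ℝ] ℝ,
        ∑ l, f l ((Pi.single k T : Idx n → Block n) l) = f k T := fun f => by
      rw [Finset.sum_eq_single k (fun l _ hl => by simp [hl]) (by simp), Pi.single_eq_same]
    simpa only [g₃Lin_apply, EqSystem.lhsLin_apply, hs] using h
  have hvec : ∀ k, blockVec x U k + ∑ j, lam j • (D.blocks j k).2.1 = 0 := fun k => by
    -- With zero matrix part the linear part is free; testing with the residual itself bounds its
    -- squared norm by 0.
    have h := hblock k (0, blockVec x U k + ∑ j, lam j • (D.blocks j k).2.1, 0) (by simp)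
    rw [← dotProduct_self_eq_zero]
    refine le_antisymm (le_of_eq_of_le ?_ h) (dotProduct_self_nonneg _)
    rw [add_dotProduct, sum_dotProduct]
    simp [perspective_apply, pairing_apply, matInner, mul_add]
  have hweight : ∀ k, blockWeight x k + ∑ j, lam j * (D.blocks j k).2.2 = 0 := fun k => by
    have h := hblock k (0, 0, blockWeight x k + ∑ j, lam j * (D.blocks j k).2.2) (by simp)
    rw [← mul_self_eq_zero]
    refine le_antisymm (le_of_eq_of_le ?_ h) (mul_self_nonneg _)
    rw [add_mul, Finset.sum_mul]
    simp [perspective_apply, pairing_apply, matInner, mul_assoc]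
  have hsymm : ∀ j k, (D.blocks j k).1.IsSymm := fun j k => by
    rcases k with i | i | i
    exacts [hD.symm_A j i, hD.symm_B j i, hD.symm_Ξ j]
  -- The least matrix allowed by the bordered constraint, by `schur_posSemidef`.
  let Y : Idx n → Matrix (Fin n) (Fin n) ℝ := fun k =>
    (1 / blockWeight x k) • vecMulVec (blockVec x U k) (blockVec x U k)
  have hlmi : ∀ k, (-(Y k + ∑ j, lam j • (D.blocks j k).1)).PosSemidef := fun k => by
    refine PosSemidef.of_dotProduct_mulVec_nonneg ?_ fun y => ?_
    -- Symmetry of the data matrices is needed here; the quadratic forms alone do not see it.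
    · rw [IsHermitian, conjTranspose_eq_transpose_of_trivial, transpose_neg, transpose_add,
        transpose_sum]
      simp only [transpose_smul, (hsymm _ k).eq, Y, transpose_vecMulVec]
    -- Rank-one test matrices `y yᵀ` recover the quadratic form of the required matrix inequality.
    · have h := hblock k (vecMulVec y y, 0, 0) fun u => by
        simpa [vecMulVec_mulVec, dotProduct_comm y u] using mul_self_nonneg (u ⬝ᵥ y)
      simp only [perspective_apply, pairing_apply, matInner_vecMulVec, dotProduct_zero, mul_zero,
        add_zero] at h
      rw [star_trivial, neg_mulVec, dotProduct_neg, neg_nonneg, add_mulVec, sum_mulVec,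
        dotProduct_add, dotProduct_sum]
      refine le_of_eq_of_le ?_ h
      simp [Y, smul_mulVec, vecMulVec_mulVec, dotProduct_comm y]
  refine ⟨_, _, lam, (sdpFeasible_iff D Xbar (SDPVar.ofBlocks x U Y lam)).2 ⟨hxU, fun k => ?_⟩,
    EReal.coe_le_coe_iff.2 hval⟩
  rw [SDPVar.blocks_ofBlocks]
  exact ⟨hlmi k, hvec k, hweight k, bordered_posSemidef _ (blockWeight_nonneg hx k) (hnd k)⟩

end SLC

end

/-! ### Minimization over `(x, U)` -/

theorem mainTheorem3 (n m : ℕ) (p : MvPolynomial (Fin n) ℝ) (hp : p.totalDegree ≤ 3)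
    (D : SLC.EqSystem n m) (hD : D.Matches p)
    (Xbar : Set ((Fin n → ℝ) × Matrix (Fin n) (Fin n) ℝ))
    (hXbar : ∀ x U, (x, U) ∈ Xbar → ∀ i, 0 ≤ x i ∧ x i ≤ 1) :
    (∀ (x : Fin n → ℝ) (U : Matrix (Fin n) (Fin n) ℝ),
      SLC.IsMinMaxOptimal D Xbar x U ↔
        ∃ (Y : Fin (n + 1) → Matrix (Fin n) (Fin n) ℝ) (R : Fin n → Matrix (Fin n) (Fin n) ℝ)
          (lam : Fin m → ℝ), SLC.IsSDPOptimal D Xbar ⟨x, U, Y, R, lam⟩) ∧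
    (⨅ q ∈ Xbar, SLC.innerMax D q.1 q.2) =
      ⨅ (v : SLC.SDPVar n m) (_ : SLC.SDPFeasible D Xbar v),
        ((SLC.sdpObjective D v : ℝ) : EReal) := by
  have strong := fun {x U} (h : (x, U) ∈ Xbar) =>
    SLC.exists_sdpFeasible_le_innerMax hp hD h (hXbar x U h)
  refine ⟨fun x U => ⟨?_, ?_⟩, le_antisymm ?_ ?_⟩
  · rintro ⟨hmem, hfin, hopt⟩
    obtain ⟨Y, R, lam, hfeas, hle⟩ := strong hmem hfin
    exact ⟨Y, R, lam, hfeas, fun v' hv' => EReal.coe_le_coe_iff.1 <|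
      (hle.trans (hopt _ _ hv'.mem)).trans (SLC.innerMax_le_sdpObjective hv')⟩
  · rintro ⟨Y, R, lam, hfeas, hopt⟩
    have hweak := SLC.innerMax_le_sdpObjective hfeas
    refine ⟨hfeas.mem, (hweak.trans_lt (EReal.coe_lt_top _)).ne, fun x' U' hmem => ?_⟩
    by_cases hfin : SLC.innerMax D x' U' = ⊤
    · exact hfin ▸ le_top
    · obtain ⟨Y', R', lam', hfeas', hle⟩ := strong hmem hfin
      exact (hweak.trans (EReal.coe_le_coe_iff.2 (hopt _ hfeas'))).trans hle
  · exact le_iInf₂ fun v hv => (iInf₂_le (v.x, v.U) hv.mem).trans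
      (SLC.innerMax_le_sdpObjective hv)
  · refine le_iInf₂ fun q hq => ?_
    by_cases hfin : SLC.innerMax D q.1 q.2 = ⊤
    · exact hfin ▸ le_top
    · obtain ⟨Y, R, lam, hfeas, hle⟩ := strong hq hfin
      exact (iInf₂_le _ hfeas).trans hle
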